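/- **Notation.** Let $\mathbb K$ be a number field with algebraic closure $\overline{\mathbb K}$, and let $f(X)\in\mathbb K(X)$ be a rational function of degree $d\ge 2$ (the maximum of the degrees of numerator and denominator in lowest terms), regarded as a self-map of $\mathbb P^1=\mathbb A^1\cup\{\infty\}$; $f^{(n)}$ denotes its $n$-th iterate ($n\ge 0$) and $\mathcal O_f(\alpha)=\{f^{(n)}(\alpha):n\ge 0\}$ the forward orbit of $\alpha$. A point is wandering if its orbit is infinite. Let $h$ be the absolute logarithmic Weil height on $\mathbb P^1(\overline{\mathbb K})$ (so $h(\infty)=0$), and let $$\hat h_f(\gamma)=\lim_{n\to\infty}d^{-n}h\bigl(f^{(n)}(\gamma)\bigr),\qquad \gamma\in\mathbb P^1(\overline{\mathbb K}),$$ be the canonical height of $f$. Let $C_1(f)$ denote any constant such that $$-C_1(f)\le \hat h_f(\gamma)-h(\gamma)\le C_1(f)\quad\text{for all }\gamma\in\mathbb P^1(\overline{\mathbb K});$$ such constants exist. Let $k\ge 1$. A polynomial $F\in\mathbb K[T_1,\dots,T_k]$ is a *multilinear polynomial with split variables* if there are a partition $\{1,\dots,k\}=J_1\sqcup\dots\sqcup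 J_r$ into nonempty sets and scalars $c_1,\dots,c_r\in\mathbb K^*$ with $$F(T_1,\dots,T_k)=\sum_{i=1}^r c_i\prod_{j\in J_i}T_j .$$ Its height is $h(F)=\max_{1\le i\le r}h(c_i)$. **Theorem.** Let $F(T_1,\dots,T_k)\in\mathbb K[T_1,\dots,T_k]$ be a multilinear polynomial with split variables, and let $f$ be as above. Consider the equation $$F\bigl(f^{(n_1)}(\alpha),f^{(n_2)}(\alpha),\dots,f^{(n_k)}(\alpha)\bigr)=0,\tag{$*$}$$ where satisfying $(*)$ includes the requirement that all the values $f^{(n_i)}(\alpha)$ are finite. (a) The set of $\alpha\in\overline{\mathbb K}$ for which there is a $k$-tuple of distinct non-negative integers $(n_1,\dots,n_k)$ satisfying $(*)$ is a set of bounded height. (b) If $d\ge 3$, then every $\alpha$ as in (a) satisfies $$h(\alpha)\le \frac{2k}{d^{k-1}}h(F)+\frac73 C_1(f)+\frac29\log 2 .$$ (c) Let $\alpha\in\mathbb P^1(\mathbb K)$ be a wandering point with $0\notin\mathcal O_f(\alpha)$. Then there are only finitely many $k$-tuples of integers $n_1>n_2>\dots>n_k\ge 0$ satisfying $(*)$,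 and their number is bounded by a constant that depends only on $\mathbb K$, $f$ and $F$, and not on $\alpha$. -/

import Mathlib

open Filter

noncomputable section

namespace OrbitRelation

open Polynomial

variable {K : Type*} [Field K]

/-- The degree of a rational function `f = p / q` in lowest terms: `max (deg p) (deg q)`. -/
def ratDegree (f : RatFunc K) : ℕ :=
  max f.num.natDegree f.denom.natDegree

/-- The self-map of the projective line `P¹(L) = L ∪ {∞}` induced by a rational function
`f = p / q` (in lowest terms) with coefficients in a subfield `K` of `L`.  A finite point `x` goes
to `p(x) / q(x)`, or to `∞` if `q(x) = 0`.  The point `∞` goes to the quotient of the coefficients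
of degree `d = max (deg p) (deg q)` of `p` and `q`, or to `∞` if that coefficient of `q` is `0`. -/
def ratMap (L : Type*) [Field L] [Algebra K L] (f : RatFunc K) : OnePoint L → OnePoint L :=
  open Classical in
  fun a => OnePoint.elim a
    (if f.denom.coeff (ratDegree f) = 0 then OnePoint.infty
      else ((algebraMap K L (f.num.coeff (ratDegree f) / f.denom.coeff (ratDegree f)) : L) :
        OnePoint L))
    (fun x : L => if aeval x f.denom = 0 then OnePoint.infty
      else ((aeval x f.num / aeval x f.denom : L) : OnePoint L))

/-- The forward orbit of a point of `P¹(L)` under `f`. -/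
def orbit (L : Type*) [Field L] [Algebra K L] (f : RatFunc K) (a : OnePoint L) :
    Set (OnePoint L) :=
  Set.range fun n : ℕ => (ratMap L f)^[n] a

/-- A point is wandering if its forward orbit is infinite, that is, if it is not preperiodic. -/
def IsWandering (L : Type*) [Field L] [Algebra K L] (f : RatFunc K) (a : OnePoint L) : Prop :=
  (orbit L f a).Infinite

/-- The absolute logarithmic Weil height on `P¹(L)`, where `L` is algebraic over `ℚ`; the height
of `∞ = [1 : 0]` is `0`. -/
def height {L : Type*} [Field L] [CharZero L] : OnePoint L → ℝ :=
  fun a => OnePoint.elim a 0 fun x : L => NumberField.absLogHeight₁ x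

/-- The canonical height `lim_n d⁻ⁿ h(fⁿ(γ))` on `P¹` of the algebraic closure of `K`. -/
def canonicalHeight [CharZero K] (f : RatFunc K) (γ : OnePoint (AlgebraicClosure K)) : ℝ :=
  limUnder atTop fun n : ℕ =>
    height ((ratMap (AlgebraicClosure K) f)^[n] γ) / (ratDegree f : ℝ) ^ n

/-- `C` bounds the difference between the canonical height of `f` and the Weil height on `P¹` of
the algebraic closure of `K`. -/
def IsHeightDifferenceBound [CharZero K] (f : RatFunc K) (C : ℝ) : Prop :=
  ∀ γ : OnePoint (AlgebraicClosure K),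
    -C ≤ canonicalHeight f γ - height γ ∧ canonicalHeight f γ - height γ ≤ C

/-- `F` is a multilinear polynomial with split variables: there are a partition of the set of
variables into nonempty parts `J` and nonzero scalars `c J` with `F = ∑_J c_J ∏_{j ∈ J} T_j`. -/
def IsSplitMultilinear {k : ℕ} (F : MvPolynomial (Fin k) K) : Prop :=
  ∃ (P : Finpartition (Finset.univ : Finset (Fin k))) (c : Finset (Fin k) → K),
    (∀ J ∈ P.parts, c J ≠ 0) ∧
      F = ∑ J ∈ P.parts, MvPolynomial.C (c J) * ∏ j ∈ J, MvPolynomial.X j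

/-- The height of a polynomial: the maximum of the absolute logarithmic Weil heights of its
nonzero coefficients.  For a multilinear polynomial with split variables, these are the scalars
`c J`. -/
def polyHeight [CharZero K] {k : ℕ} (F : MvPolynomial (Fin k) K) : ℝ :=
  ⨆ m : F.support, NumberField.absLogHeight₁ (F.coeff m)

/-- The iterates `f^{n_1}(a), …, f^{n_k}(a)` are all finite and `F` vanishes at them. -/
def IsSolution (L : Type*) [Field L] [Algebra K L] (f : RatFunc K) {k : ℕ}
    (F : MvPolynomial (Fin k) K) (a : OnePoint L) (n : Fin k → ℕ) : Prop :=
  ∃ x : Fin k → L, (∀ i, (ratMap L f)^[n i] a = (x i : OnePoint L)) ∧ MvPolynomial.aeval x F = 0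

/-- The elements `α` of the algebraic closure of `K` such that
`F(f^{n_1}(α), …, f^{n_k}(α)) = 0` for some pairwise distinct `n_1, …, n_k ≥ 0`. -/
def exceptionalSet (f : RatFunc K) {k : ℕ} (F : MvPolynomial (Fin k) K) :
    Set (AlgebraicClosure K) :=
  {α | ∃ n : Fin k → ℕ, Function.Injective n ∧
    IsSolution (AlgebraicClosure K) f F (α : OnePoint (AlgebraicClosure K)) n}

end OrbitRelation

end

/-! Canonical heights satisfy ĥ(f^(n)(α)) = dⁿ ĥ(α) and differ from Weil heights by at most C. If no
entry of the relation is zero, F, being linear in each variable, can be solved for the entry of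
largest index n_i. The height of that entry is then at most the sum of the other heights plus k·h(F)
+ log(k-1) (`absLogHeight₁_le_sum_of_aeval_eq_zero`). In terms of ĥ this reads (d^(n_i) - ∑_{j≠i}
d^(n_j)) ĥ(α) ≤ B with B = kC + k·h(F) + log(k-1). As the indices are distinct, the bracket is at
least d^(n_i-(k-1)) (`sum_pow_add_pow_le`), and at least d^(n_i)/2 if d ≥ 3 (`two_mul_sum_pow_le`).

This bounds ĥ(α), which gives (a) and, since n_i ≥ k-1, also (b). A zero entry at index n gives dⁿ
ĥ(α) ≤ C directly. For (c), Northcott's theorem yields δ > 0 with ĥ ≥ δ at all wandering K-points,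
so d^(n_i-(k-1)) ≤ B/δ bounds every index uniformly in α.

The groundwork is that h(f(γ)) - d·h(γ) is bounded uniformly over all number fields containing K:
from above by the size of the coefficients, from below by Bézout identities
(`exists_homForms_certificate`). -/

/-! ### Heights under extension of number fields. -/

namespace NumberField

open Height IntermediateField

/-- A product over the infinite places, weighted by their multiplicities, as a product over the
complex embeddings. -/
theorem prod_infinitePlace_pow_mult_eq {K M : Type*} [Field K] [NumberField K] [CommMonoid M]
    (g : InfinitePlace K → M) :
    ∏ v : InfinitePlace K, g v ^ v.mult = ∏ φ : K →+* ℂ, g (InfinitePlace.mk φ) := by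
  classical
  rw [← Finset.prod_fiberwise Finset.univ InfinitePlace.mk (fun φ ↦ g (InfinitePlace.mk φ))]
  refine Finset.prod_congr rfl fun v _ ↦ ?_
  rw [← InfinitePlace.card_filter_mk_eq v, ← Finset.prod_const]
  exact Finset.prod_congr rfl fun φ hφ ↦ by rw [(Finset.mem_filter.mp hφ).2]

/-- Every complex embedding of a number field `K` has exactly `[L : K]` extensions to `L`. -/
theorem card_filter_comp_algebraMap_eq {K L : Type*} [Field K] [NumberField K] [Field L]
    [NumberField L] [Algebra K L] [DecidableEq (K →+* ℂ)] (φ : K →+* ℂ) :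
    (Finset.univ.filter fun ψ : L →+* ℂ ↦ ψ.comp (algebraMap K L) = φ).card =
      Module.finrank K L := by
  let := φ.toAlgebra
  rw [← AlgHom.card K L ℂ, ← Fintype.card_subtype]
  refine Fintype.card_congr
    ⟨fun ψ ↦ { ψ.1 with commutes' := fun x ↦ congrArg (fun χ ↦ χ x) ψ.2 },
      fun ψ ↦ ⟨ψ.toRingHom, ψ.comp_algebraMap⟩, fun _ ↦ rfl, fun _ ↦ rfl⟩

/-- The height of a fraction of integers, cleared of its finite part. -/
theorem mulHeight₁_div_mul_absNorm_span {M : Type*} [Field M] [NumberField M] (c : 𝓞 M)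
    {d : 𝓞 M} (hd : d ≠ 0) :
    mulHeight₁ ((c : M) / d) * (Ideal.span (Set.range ![c, d])).absNorm =
      ∏ φ : M →+* ℂ, max ‖φ c‖ ‖φ d‖ := by
  have hx : (![c, d] : Fin 2 → 𝓞 M) ≠ 0 := fun h ↦ hd (congrFun h 1)
  have hx' : (![(c : M), (d : M)] : Fin 2 → M) ≠ 0 := fun h ↦
    hd (RingOfIntegers.coe_eq_zero_iff.mp (congrFun h 1))
  -- The finite places contribute exactly the inverse of the norm of the ideal (c, d).
  have h1 := absNorm_mul_finprod_finitePlace_eq_one hx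
  have hco : ∀ i, ((![c, d] i : 𝓞 M) : M) = ![(c : M), (d : M)] i := by
    intro i; fin_cases i <;> rfl
  simp only [hco] at h1
  rw [mulHeight₁_div_eq_mulHeight, mulHeight_eq hx', mul_assoc, mul_comm (∏ᶠ _, _), h1, mul_one,
    prod_infinitePlace_pow_mult_eq (fun v ↦ ⨆ i, v (![(c : M), (d : M)] i))]
  refine Finset.prod_congr rfl fun φ _ ↦ ?_
  refine le_antisymm (ciSup_le fun i ↦ ?_) (max_le ?_ ?_)
  · fin_cases i <;> simp
  · exact Finite.le_ciSup_of_le 0 (by simp)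
  · exact Finite.le_ciSup_of_le 1 (by simp)

/-- The multiplicative height relative to a number field is raised to the power `[L : K]` when
passing from `K` to `L`. -/
theorem mulHeight₁_algebraMap {K L : Type*} [Field K] [NumberField K] [Field L]
    [NumberField L] [Algebra K L] (x : K) :
    mulHeight₁ (algebraMap K L x) = mulHeight₁ x ^ Module.finrank K L := by
  classical
  -- With integral numerator and denominator, the splitting of finite places in L need not be
  -- followed: the ideal norm is raised to the power [L : K], and so is the product over embeddings.
  obtain ⟨a, b, hb, rfl⟩ := IsFractionRing.div_surjective (A := 𝓞 K) x
  have hb0 : b ≠ 0 := nonZeroDivisors.ne_zero hb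
  have hK := mulHeight₁_div_mul_absNorm_span a hb0
  have hbL : algebraMap (𝓞 K) (𝓞 L) b ≠ 0 := by
    rwa [Ne, FaithfulSMul.algebraMap_eq_zero_iff]
  have hL := mulHeight₁_div_mul_absNorm_span (algebraMap (𝓞 K) (𝓞 L) a) hbL
  have hnorm : (Ideal.span (Set.range ![algebraMap (𝓞 K) (𝓞 L) a, algebraMap (𝓞 K) (𝓞 L) b])).absNorm
      = (Ideal.span (Set.range ![a, b])).absNorm ^ Module.finrank K L := by
    rw [IsFractionRing.finrank_eq (𝓞 K) K (𝓞 L) L, ← Ideal.absNorm_algebraMap, Ideal.map_span]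
    congr 2
    ext y
    simp [eq_comm]
  have hcast : ∀ y : 𝓞 K, ((algebraMap (𝓞 K) (𝓞 L) y : 𝓞 L) : L) = algebraMap K L y :=
    fun y ↦ rfl
  have hprod : ∏ ψ : L →+* ℂ, max ‖ψ (algebraMap K L a)‖ ‖ψ (algebraMap K L b)‖ =
      (∏ φ : K →+* ℂ, max ‖φ a‖ ‖φ b‖) ^ Module.finrank K L := by
    rw [← Finset.prod_pow, ← Finset.prod_fiberwise Finset.univ
      (fun ψ : L →+* ℂ ↦ ψ.comp (algebraMap K L))]
    refine Finset.prod_congr rfl fun φ _ ↦ ?_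
    rw [← card_filter_comp_algebraMap_eq (L := L) φ, ← Finset.prod_const]
    refine Finset.prod_congr rfl fun ψ hψ ↦ ?_
    rw [← (Finset.mem_filter.mp hψ).2]
    rfl
  have hN : ((Ideal.span (Set.range ![a, b])).absNorm : ℝ) ≠ 0 := by
    rw [Nat.cast_ne_zero, Ne, Ideal.absNorm_eq_zero_iff, Ideal.span_eq_bot]
    exact fun h ↦ hb0 (h b ⟨1, rfl⟩)
  rw [hcast, hcast, hnorm, hprod, ← hK, mul_pow, Nat.cast_pow] at hL
  rw [map_div₀]
  exact mul_right_cancel₀ (pow_ne_zero _ hN) hL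

theorem logHeight₁_algebraMap {K L : Type*} [Field K] [NumberField K] [Field L]
    [NumberField L] [Algebra K L] (x : K) :
    logHeight₁ (algebraMap K L x) = Module.finrank K L * logHeight₁ x := by
  rw [logHeight₁_eq_log_mulHeight₁, mulHeight₁_algebraMap, Real.log_pow,
    logHeight₁_eq_log_mulHeight₁]

/-- The absolute logarithmic height may be computed in any number field. -/
theorem absLogHeight₁_map {L E : Type*} [Field L] [NumberField L] [Field E] [CharZero E]
    (φ : L →+* E) (x : L) :
    absLogHeight₁ (φ x) = logHeight₁ x / Module.finrank ℚ L := by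
  have hx : IsIntegral ℚ x := Algebra.IsIntegral.isIntegral x
  let φ' : L →ₐ[ℚ] E := RingHom.toRatAlgHom φ
  have hy : IsIntegral ℚ (φ x) := hx.map φ'
  have hmin : minpoly ℚ (φ x) = minpoly ℚ x := minpoly.algHom_eq φ' φ'.injective x
  rw [absLogHeight₁, absMulHeight₁, dif_pos hy]
  have : FiniteDimensional ℚ ℚ⟮φ x⟯ := adjoin.finiteDimensional hy
  have : NumberField ℚ⟮φ x⟯ := {}
  have hroot : Polynomial.aeval x (minpoly ℚ (φ x)) = 0 := by
    rw [hmin]; exact minpoly.aeval ℚ x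
  -- `x` and `φ x` share a minimal polynomial, so the field that defines the absolute height embeds
  -- into L with generator going to `x`.
  let ψ : ℚ⟮φ x⟯ →ₐ[ℚ] L := (adjoin.powerBasis hy).lift x (by
    rw [adjoin.powerBasis_gen, minpoly_gen]; exact hroot)
  have hψ : ψ (AdjoinSimple.gen ℚ (φ x)) = x := by
    rw [← adjoin.powerBasis_gen hy]
    exact PowerBasis.lift_gen _ _ _
  let := ψ.toRingHom.toAlgebra
  have h := logHeight₁_algebraMap (L := L) (AdjoinSimple.gen ℚ (φ x))
  have h' : algebraMap ℚ⟮φ x⟯ L (AdjoinSimple.gen ℚ (φ x)) = x := hψ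
  have hfin : Module.finrank ℚ ℚ⟮φ x⟯ * Module.finrank ℚ⟮φ x⟯ L = Module.finrank ℚ L :=
    Module.finrank_mul_finrank ℚ ℚ⟮φ x⟯ L
  have h1 : (Module.finrank ℚ ℚ⟮φ x⟯ : ℝ) ≠ 0 := Nat.cast_ne_zero.mpr Module.finrank_pos.ne'
  have h2 : (Module.finrank ℚ⟮φ x⟯ L : ℝ) ≠ 0 := by
    refine Nat.cast_ne_zero.mpr fun h0 ↦ ?_
    rw [h0, mul_zero] at hfin
    exact Module.finrank_pos.ne hfin
  rw [h'] at h
  rw [h, ← hfin, Nat.cast_mul, Real.log_rpow (mulHeight₁_pos _), ← logHeight₁_eq_log_mulHeight₁]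
  field_simp

end NumberField

/-! ### Arithmetic of absolute heights of algebraic numbers. -/

namespace NumberField

open Height IntermediateField

section Algebraic

variable {E : Type*} [Field E] [CharZero E]

theorem absLogHeight₁_nonneg (x : E) : 0 ≤ absLogHeight₁ x := by
  rw [absLogHeight₁, absMulHeight₁]
  split_ifs with hx
  · have : FiniteDimensional ℚ ℚ⟮x⟯ := adjoin.finiteDimensional hx
    have : NumberField ℚ⟮x⟯ := {}
    exact Real.log_nonneg (Real.one_le_rpow (one_le_mulHeight₁ _) (by positivity))
  · simp

theorem absLogHeight₁_eq_div_finrank {L : IntermediateField ℚ E} [NumberField L] {x : E}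
    (hx : x ∈ L) :
    absLogHeight₁ x = logHeight₁ (⟨x, hx⟩ : L) / Module.finrank ℚ L :=
  absLogHeight₁_map (algebraMap L E) (⟨x, hx⟩ : L)

@[simp]
theorem absLogHeight₁_zero : absLogHeight₁ (0 : E) = 0 := by
  have := absLogHeight₁_map (algebraMap ℚ E) 0
  simpa using this

variable [Algebra.IsAlgebraic ℚ E]

/-- Finitely many algebraic numbers lie in a common number field. -/
theorem exists_numberField_forall_mem {s : Set E} (hs : s.Finite) :
    ∃ L : IntermediateField ℚ E, NumberField L ∧ ∀ x ∈ s, x ∈ L := by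
  have := hs.to_subtype
  have : FiniteDimensional ℚ (adjoin ℚ s) :=
    finiteDimensional_adjoin fun x _ ↦ Algebra.IsIntegral.isIntegral x
  exact ⟨adjoin ℚ s, {}, fun x hx ↦ subset_adjoin ℚ s hx⟩

theorem absLogHeight₁_inv (x : E) : absLogHeight₁ x⁻¹ = absLogHeight₁ x := by
  obtain ⟨L, _, hL⟩ := exists_numberField_forall_mem (Set.finite_singleton x)
  have hx : x ∈ L := hL x rfl
  rw [absLogHeight₁_eq_div_finrank hx, absLogHeight₁_eq_div_finrank (inv_mem hx),
    ← logHeight₁_inv (⟨x, hx⟩ : L)]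
  rfl

theorem absLogHeight₁_neg (x : E) : absLogHeight₁ (-x) = absLogHeight₁ x := by
  obtain ⟨L, _, hL⟩ := exists_numberField_forall_mem (Set.finite_singleton x)
  have hx : x ∈ L := hL x rfl
  rw [absLogHeight₁_eq_div_finrank hx, absLogHeight₁_eq_div_finrank (neg_mem hx),
    ← logHeight₁_neg (⟨x, hx⟩ : L)]
  rfl

theorem absLogHeight₁_mul_le (x y : E) :
    absLogHeight₁ (x * y) ≤ absLogHeight₁ x + absLogHeight₁ y := by
  obtain ⟨L, _, hL⟩ := exists_numberField_forall_mem (Set.toFinite {x, y})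
  have hx : x ∈ L := hL x (by simp)
  have hy : y ∈ L := hL y (by simp)
  rw [absLogHeight₁_eq_div_finrank hx, absLogHeight₁_eq_div_finrank hy,
    absLogHeight₁_eq_div_finrank (mul_mem hx hy), ← add_div]
  gcongr
  exact logHeight₁_mul_le (⟨x, hx⟩ : L) ⟨y, hy⟩

theorem absLogHeight₁_prod_le {ι : Type*} (s : Finset ι) (x : ι → E) :
    absLogHeight₁ (∏ i ∈ s, x i) ≤ ∑ i ∈ s, absLogHeight₁ (x i) := by
  obtain ⟨L, _, hL⟩ := exists_numberField_forall_mem (s.finite_toSet.image x)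
  have hx : ∀ i : s, x i ∈ L := fun i ↦ hL _ ⟨i, i.2, rfl⟩
  have hcoe : ∏ i ∈ s, x i = algebraMap L E (∏ i : s, (⟨x i, hx i⟩ : L)) := by
    rw [map_prod, ← Finset.prod_coe_sort]
    rfl
  rw [hcoe, absLogHeight₁_map, ← Finset.sum_coe_sort]
  rw [Finset.sum_congr rfl fun i _ ↦ absLogHeight₁_eq_div_finrank (hx i)]
  rw [← Finset.sum_div]
  gcongr
  exact logHeight₁_prod_le _ _

theorem absLogHeight₁_sum_le {ι : Type*} (s : Finset ι) (x : ι → E) :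
    absLogHeight₁ (∑ i ∈ s, x i) ≤ Real.log s.card + ∑ i ∈ s, absLogHeight₁ (x i) := by
  obtain ⟨L, _, hL⟩ := exists_numberField_forall_mem (s.finite_toSet.image x)
  have hx : ∀ i : s, x i ∈ L := fun i ↦ hL _ ⟨i, i.2, rfl⟩
  have hcoe : ∑ i ∈ s, x i = algebraMap L E (∑ i : s, (⟨x i, hx i⟩ : L)) := by
    rw [map_sum, ← Finset.sum_coe_sort]
    rfl
  have hpos : (0 : ℝ) < Module.finrank ℚ L := Nat.cast_pos.mpr Module.finrank_pos
  rw [hcoe, absLogHeight₁_map, ← Finset.sum_coe_sort s fun i ↦ absLogHeight₁ (x i)]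
  rw [Finset.sum_congr rfl fun i _ ↦ absLogHeight₁_eq_div_finrank (hx i)]
  rw [← Finset.sum_div, div_le_iff₀ hpos, add_mul, div_mul_cancel₀ _ hpos.ne']
  refine (logHeight₁_sum_le Finset.univ fun i : s ↦ (⟨x i, hx i⟩ : L)).trans (le_of_eq ?_)
  -- The total weight [L : ℚ] cancels in the normalization, so the term log |s| does not depend on
  -- L.
  rw [totalWeight_eq_finrank, Finset.card_univ, Fintype.card_coe, mul_comm]

end Algebraic

end NumberField

/-! ### Uniform constants for heights of polynomial values. -/

namespace Height

open AdmissibleAbsValues MvPolynomial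

/-- The constant in the height bound for values of polynomials is controlled by the heights of
the coefficients. -/
theorem mulHeightBound_le {K ι ι' : Type*} [Field K] [AdmissibleAbsValues K] [Fintype ι']
    [Nonempty ι'] (p : ι' → MvPolynomial ι K) {n : ℕ} (hn0 : 1 ≤ n)
    (hn : ∀ j, (p j).support.card ≤ n) :
    mulHeightBound p ≤ n ^ totalWeight K *
      ∏ t ∈ Finset.univ.sigma fun j ↦ (p j).support, mulHeight₁ ((p t.1).coeff t.2) := by
  set T := Finset.univ.sigma fun j ↦ (p j).support
  have hmem : ∀ j, ∀ s ∈ (p j).support, (⟨j, s⟩ : Σ _, ι →₀ ℕ) ∈ T := fun j s hs ↦ by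
    simpa [T] using hs
  have hle : ∀ (v : AbsoluteValue K ℝ) (j : ι'), ∀ s ∈ (p j).support,
      v ((p j).coeff s) ≤ ∏ t ∈ T, max (v ((p t.1).coeff t.2)) 1 := fun v j s hs ↦
    Finset.le_prod_max_one (hmem j s hs) fun t ↦ v ((p t.1).coeff t.2)
  have hone : ∀ v : AbsoluteValue K ℝ, 1 ≤ ∏ t ∈ T, max (v ((p t.1).coeff t.2)) 1 := fun v ↦
    T.one_le_prod fun _ _ ↦ le_max_right ..
  have hfin : ∀ t ∈ T,
      (fun v : nonarchAbsVal ↦ max (v.val ((p t.1).coeff t.2)) 1).HasFiniteMulSupport := by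
    intro t ht
    have : (p t.1).coeff t.2 ≠ 0 := by simpa [T] using ht
    fun_prop (disch := assumption)
  have hsupfin : (fun v : nonarchAbsVal ↦
      ⨆ j, max (⨆ s : (p j).support, v.val (coeff s.val (p j))) 1).HasFiniteMulSupport := by
    refine Function.HasFiniteMulSupport.iSup fun j ↦ ?_
    rcases isEmpty_or_nonempty (p j).support with hs₀ | hs₀
    · simp [Function.hasFiniteMulSupport_one]
    have H (s : (p j).support) : coeff s.val (p j) ≠ 0 := mem_support_iff.mp s.prop
    fun_prop (disch := simp [H])
  have hprodfin : (fun v : nonarchAbsVal ↦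
      ∏ t ∈ T, max (v.val ((p t.1).coeff t.2)) 1).HasFiniteMulSupport := by
    refine Set.Finite.subset (Set.Finite.biUnion T.finite_toSet hfin) fun v hv ↦ ?_
    obtain ⟨t, ht, h⟩ := Finset.exists_ne_one_of_prod_ne_one hv
    exact Set.mem_biUnion ht h
  simp only [mulHeight₁_eq, totalWeight, mulHeightBound_eq]
  rw [Finset.prod_mul_distrib, ← Multiset.prod_replicate, ← Multiset.map_const,
    ← finprod_prod_comm _ _ hfin, ← Multiset.prod_map_prod, ← mul_assoc, ← Multiset.prod_map_mul]
  simp only [Function.const_apply]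
  gcongr
  · exact finprod_nonneg fun _ ↦ Real.iSup_nonneg fun _ ↦ by positivity
  · exact Multiset.prod_map_nonneg fun _ h ↦ by positivity
  · refine Multiset.prod_map_le_prod_map₀ _ _ (fun v _ ↦ Real.iSup_nonneg fun _ ↦
      Finsupp.sum_nonneg fun _ _ ↦ by positivity) fun v _ ↦ ciSup_le fun j ↦ ?_
    -- Only archimedean places pay the number of monomials; at the others the maximum of the
    -- coefficients suffices.
    refine (Finset.sum_le_card_nsmul _ _ _ (hle v j)).trans ?_
    rw [nsmul_eq_mul]
    have := hone v
    gcongr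
    exact hn j
  · refine finprod_le_finprod hsupfin (fun _ ↦ Real.iSup_nonneg fun _ ↦ by positivity)
      hprodfin fun v ↦ ciSup_le fun j ↦ max_le ?_ (hone v)
    exact Real.iSup_le (fun s ↦ hle v j s s.2) (zero_le_one.trans (hone v))

end Height

namespace Height

open MvPolynomial NumberField

/-- The constant in the height bound for values of polynomials over a number field `K` grows at
most linearly with the degree of the extensions of `K`. -/
theorem exists_log_mulHeightBound_map_le {K ι ι' : Type*} [Field K] [NumberField K] [Fintype ι']
    [Nonempty ι'] (p : ι' → MvPolynomial ι K) :
    ∃ c : ℝ, ∀ (L : Type*) [Field L] [NumberField L] [Algebra K L],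
      Real.log (max (mulHeightBound fun j ↦ (p j).map (algebraMap K L)) 1) ≤
        Module.finrank ℚ L * c := by
  obtain ⟨n, hn⟩ : ∃ n : ℕ, ∀ j, (p j).support.card ≤ n :=
    ⟨∑ j, (p j).support.card, fun j ↦
      Finset.single_le_sum (f := fun j ↦ (p j).support.card) (fun _ _ ↦ zero_le) (Finset.mem_univ j)⟩
  set T := Finset.univ.sigma fun j ↦ (p j).support
  -- Taking n + 1 keeps the base at least 1, even if all polynomials vanish.
  refine ⟨Real.log ((n + 1 : ℕ) : ℝ) + ∑ t ∈ T, logHeight₁ ((p t.1).coeff t.2),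
    fun L _ _ _ ↦ ?_⟩
  have hsupp : ∀ j, ((p j).map (algebraMap K L)).support = (p j).support := fun j ↦
    support_map_of_injective _ (algebraMap K L).injective
  have hb := mulHeightBound_le (fun j ↦ (p j).map (algebraMap K L)) (n := n + 1) (by lia)
    fun j ↦ by rw [hsupp]; exact (hn j).trans (by lia)
  simp_rw [hsupp, coeff_map, mulHeight₁_algebraMap, totalWeight_eq_finrank] at hb
  change _ ≤ _ * ∏ t ∈ T, _ at hb
  have hone : (1 : ℝ) ≤ ((n + 1 : ℕ) : ℝ) ^ Module.finrank ℚ L *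
      ∏ t ∈ T, mulHeight₁ ((p t.1).coeff t.2) ^ Module.finrank K L :=
    one_le_mul_of_one_le_of_one_le (one_le_pow₀ (by simp))
      (T.one_le_prod fun _ _ ↦ one_le_pow₀ (one_le_mulHeight₁ _))
  refine (Real.log_le_log (by positivity) (max_le hb hone)).trans ?_
  rw [Real.log_mul (by positivity) (by positivity), Real.log_prod (fun _ _ ↦ by positivity),
    Real.log_pow, mul_add, Finset.mul_sum]
  gcongr with t ht
  rw [Real.log_pow, ← logHeight₁_eq_log_mulHeight₁]
  have := zero_le_logHeight₁ ((p t.1).coeff t.2)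
  gcongr
  have h : Module.finrank ℚ K * Module.finrank K L = Module.finrank ℚ L :=
    Module.finrank_mul_finrank ℚ K L
  rw [← h]
  exact Nat.le_mul_of_pos_left _ Module.finrank_pos

end Height

/-! ### Bézout's identity with degree control. -/

namespace Polynomial

/-- Bézout's identity with degree bounds. -/
theorem exists_mul_add_mul_eq_of_natDegree_le {K : Type*} [Field K] {p q r : K[X]} {d : ℕ}
    (hpq : IsCoprime p q) (hd0 : 1 ≤ d) (hd : max p.natDegree q.natDegree = d)
    (hr : r.natDegree ≤ d + d) :
    ∃ A B : K[X], A.natDegree ≤ d ∧ B.natDegree ≤ d ∧ A * p + B * q = r := by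
  wlog hp : q.natDegree ≤ p.natDegree generalizing p q
  · obtain ⟨A, B, hA, hB, h⟩ := this hpq.symm (by rwa [max_comm]) (by lia)
    exact ⟨B, A, hB, hA, by rw [add_comm, h]⟩
  rw [max_eq_left hp] at hd
  obtain ⟨u, v, huv⟩ := hpq
  -- Reducing the cofactor of `q` modulo `p` moves the quotient to the cofactor of `p`, whose degree
  -- is then read off from A * p = r - B * q.
  have hB : ((r * v) % p).natDegree < d := hd ▸ natDegree_mod_lt _ (by lia)
  have heq : (r * u + (r * v) / p * q) * p + (r * v) % p * q = r := by
    linear_combination r * huv + q * (EuclideanDomain.div_add_mod (r * v) p)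
  refine ⟨_, _, ?_, hB.le, heq⟩
  have hp0 : p ≠ 0 := fun h ↦ by simp [h] at hd; lia
  rcases eq_or_ne (r * u + (r * v) / p * q) 0 with hA | hA
  · simp [hA]
  have h1 : ((r * u + (r * v) / p * q) * p).natDegree ≤ d + d := by
    rw [eq_sub_of_add_eq heq]
    refine (natDegree_sub_le _ _).trans (max_le hr (natDegree_mul_le.trans ?_))
    lia
  rw [natDegree_mul hA hp0] at h1
  lia

end Polynomial

/-! ### Rational maps in homogeneous coordinates. -/

namespace OrbitRelation

open Polynomial Height NumberField

section Homogeneous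

variable {K : Type*} [Field K]

/-- The pair of binary forms of degree `ratDegree f` that defines `f` on the projective line. -/
noncomputable def homForms (f : RatFunc K) : Fin 2 → MvPolynomial (Fin 2) K :=
  ![f.num.homogenize (ratDegree f), f.denom.homogenize (ratDegree f)]

theorem isHomogeneous_homForms (f : RatFunc K) (j : Fin 2) :
    (homForms f j).IsHomogeneous (ratDegree f) := by
  fin_cases j <;> exact isHomogeneous_homogenize _

/-- Homogenize, in degree 2d, the Bézout identities of the coprime numerator and denominator with
right-hand sides X^(2d) and 1. Such identities bound the height of the image from below. -/
theorem exists_homForms_certificate (f : RatFunc K) (hd : 1 ≤ ratDegree f) :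
    ∃ q : Fin 2 × Fin 2 → MvPolynomial (Fin 2) K, (∀ a, (q a).IsHomogeneous (ratDegree f)) ∧
      ∀ k, ∑ j, q (k, j) * homForms f j =
        MvPolynomial.X k ^ (ratDegree f + ratDegree f) := by
  set d := ratDegree f with hdf
  have key : ∀ r : K[X], r.natDegree ≤ d + d → ∃ q : Fin 2 → MvPolynomial (Fin 2) K,
      (∀ a, (q a).IsHomogeneous d) ∧ ∑ j, q j * homForms f j = r.homogenize (d + d) := by
    intro r hr
    obtain ⟨A, B, hA, hB, h⟩ := exists_mul_add_mul_eq_of_natDegree_le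
      f.isCoprime_num_denom hd rfl hr
    refine ⟨![A.homogenize d, B.homogenize d], fun a ↦ ?_, ?_⟩
    · fin_cases a <;> exact isHomogeneous_homogenize _
    · rw [← h, homogenize_add, homogenize_mul _ _ (n := d) hA (le_max_left _ _),
        homogenize_mul _ _ (n := d) hB (le_max_right _ _)]
      simp [homForms, ← hdf]
  obtain ⟨q₀, h₀, e₀⟩ := key (X ^ (d + d)) (natDegree_X_pow_le _)
  obtain ⟨q₁, h₁, e₁⟩ := key 1 (by simp)
  refine ⟨fun a ↦ (![q₀, q₁] a.1) a.2, fun ⟨a, b⟩ ↦ ?_, fun k ↦ ?_⟩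
  · fin_cases a
    exacts [h₀ b, h₁ b]
  · fin_cases k
    · rw [homogenize_X_pow le_rfl] at e₀
      simpa using e₀
    · rw [homogenize_one] at e₁
      simpa using e₁

/-- The point of the projective line with given homogeneous coordinates. -/
noncomputable def mkPoint {L : Type*} [Field L] (y : Fin 2 → L) : OnePoint L :=
  open Classical in if y 1 = 0 then OnePoint.infty else ((y 0 / y 1 : L) : OnePoint L)

/-- Homogeneous coordinates of a point of the projective line. -/
noncomputable def coords {L : Type*} [Field L] (a : OnePoint L) : Fin 2 → L :=
  OnePoint.elim a ![1, 0] fun x ↦ ![x, 1]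

@[simp]
theorem mkPoint_coords {L : Type*} [Field L] (a : OnePoint L) : mkPoint (coords a) = a := by
  induction a using OnePoint.rec <;> simp [mkPoint, coords]

/-- Evaluation at (x, 1) dehomogenizes, and evaluation at (1, 0) keeps only the coefficient of
degree d. -/
theorem ratMap_eq_mkPoint {L : Type*} [Field L] [Algebra K L] (f : RatFunc K) (a : OnePoint L) :
    ratMap L f a = mkPoint fun j ↦ MvPolynomial.aeval (coords a) (homForms f j) := by
  induction a using OnePoint.rec with
  | infty =>
    have h : ∀ p : K[X], MvPolynomial.aeval ![(1 : L), 0] (p.homogenize (ratDegree f)) =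
        algebraMap K L (p.coeff (ratDegree f)) := by
      intro p
      rw [homogenize, map_sum, Finset.sum_eq_single (ratDegree f, 0)]
      · simp [MvPolynomial.aeval_monomial, Finsupp.prod_fintype]
      · rintro ⟨i, j⟩ hij hne
        have hj : j ≠ 0 := by
          rintro rfl
          exact hne (by simpa using hij)
        simp [MvPolynomial.aeval_monomial, Finsupp.prod_fintype, hj]
      · simp
    have h' := h f.denom
    by_cases h0 : f.denom.coeff (ratDegree f) = 0 <;>
      simp_all [ratMap, mkPoint, coords, homForms]
  | coe x =>
    have h : ∀ p : K[X], p.natDegree ≤ ratDegree f →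
        MvPolynomial.aeval ![x, 1] (p.homogenize (ratDegree f)) = aeval x p := fun p hp ↦
      aeval_homogenize_of_eq_one hp _ rfl
    have h₁ := h f.num (le_max_left _ _)
    have h₂ := h f.denom (le_max_right _ _)
    by_cases h0 : aeval x f.denom = 0 <;> simp_all [ratMap, mkPoint, coords, homForms]

end Homogeneous

theorem height_mkPoint {L : Type*} [Field L] [NumberField L] (y : Fin 2 → L) :
    height (mkPoint y) = logHeight y / Module.finrank ℚ L := by
  have hy : y = ![y 0, y 1] := by ext i; fin_cases i <;> rfl
  rw [mkPoint]
  split_ifs with h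
  -- Division by zero yields 0, whose height agrees with that of ∞.
  · rw [hy, h, ← logHeight₁_div_eq_logHeight]
    simp [height]
  · rw [hy, ← logHeight₁_div_eq_logHeight]
    exact absLogHeight₁_map (RingHom.id L) _

variable {K : Type*} [Field K] [NumberField K]

/-- A rational map of degree `d` multiplies heights by `d` up to a bounded error, uniformly in all
number fields containing its field of definition. -/
theorem exists_abs_height_ratMap_sub_le (f : RatFunc K) (hd : 1 ≤ ratDegree f) :
    ∃ C : ℝ, ∀ (L : Type*) [Field L] [NumberField L] [Algebra K L] (a : OnePoint L),
      |height (ratMap L f a) - ratDegree f * height a| ≤ C := by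
  obtain ⟨q, hq, hcert⟩ := exists_homForms_certificate f hd
  obtain ⟨c₁, h₁⟩ := exists_log_mulHeightBound_map_le (homForms f)
  obtain ⟨c₂, h₂⟩ := exists_log_mulHeightBound_map_le q
  -- `c₁` serves the upper bound and `c₂` the lower one; log 2 comes from the number of forms.
  refine ⟨max c₁ (Real.log 2 + c₂), fun L _ _ _ a ↦ ?_⟩
  specialize h₁ L
  specialize h₂ L
  have hpos : (0 : ℝ) < Module.finrank ℚ L := Nat.cast_pos.mpr Module.finrank_pos
  have hup := logHeight_eval_le (p := fun j ↦ (homForms f j).map (algebraMap K L))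
    (fun j ↦ (isHomogeneous_homForms f j).map _) (coords a)
  have hlo := logHeight_eval_ge (M := ratDegree f) (N := ratDegree f)
    (q := fun j ↦ (q j).map (algebraMap K L)) (fun j ↦ (hq j).map _)
    (fun j ↦ (homForms f j).map (algebraMap K L)) (x := coords a) fun k ↦ by
      have := congrArg (MvPolynomial.aeval (coords a)) (hcert k)
      simpa [MvPolynomial.eval_map, MvPolynomial.aeval_def] using this
  have heq : (fun j ↦ MvPolynomial.eval (coords a) ((homForms f j).map (algebraMap K L))) =
      fun j ↦ MvPolynomial.aeval (coords a) (homForms f j) := by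
    ext j
    rw [MvPolynomial.eval_map, MvPolynomial.aeval_def]
  rw [heq] at hup hlo
  have ha : height a = logHeight (coords a) / Module.finrank ℚ L := by
    rw [← height_mkPoint, mkPoint_coords]
  rw [ratMap_eq_mkPoint, height_mkPoint, ha, ← mul_div_assoc, ← sub_div, abs_div, abs_of_pos hpos,
    div_le_iff₀ hpos, abs_le]
  rw [Nat.card_eq_fintype_card, Fintype.card_fin, Nat.cast_ofNat,
    Real.log_mul (by positivity) (by positivity), Real.log_pow, totalWeight_eq_finrank] at hlo
  have m₁ := mul_le_mul_of_nonneg_left (le_max_left c₁ (Real.log 2 + c₂)) hpos.le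
  have m₂ := mul_le_mul_of_nonneg_left (le_max_right c₁ (Real.log 2 + c₂)) hpos.le
  constructor <;> linarith

end OrbitRelation

/-! ### Canonical heights and Northcott's theorem. -/

namespace OrbitRelation

open Polynomial Height NumberField Topology

theorem ratMap_map {K L E : Type*} [Field K] [Field L] [Field E] [Algebra K L] [Algebra K E]
    (φ : L →ₐ[K] E) (f : RatFunc K) (a : OnePoint L) :
    ratMap E f (a.map φ) = (ratMap L f a).map φ := by
  induction a using OnePoint.rec with
  | infty =>
    by_cases h : f.denom.coeff (ratDegree f) = 0 <;> simp [ratMap, h]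
  | coe x =>
    by_cases h : aeval x f.denom = 0 <;> simp [ratMap, h, aeval_algHom_apply]

theorem ratMap_iterate_map {K L E : Type*} [Field K] [Field L] [Field E] [Algebra K L]
    [Algebra K E] (φ : L →ₐ[K] E) (f : RatFunc K) (n : ℕ) (a : OnePoint L) :
    (ratMap E f)^[n] (a.map φ) = ((ratMap L f)^[n] a).map φ :=
  ((Function.Semiconj.iterate_right (fun a ↦ (ratMap_map φ f a).symm) n) a).symm

theorem height_map {L E : Type*} [Field L] [NumberField L] [Field E] [CharZero E]
    (φ : L →+* E) (a : OnePoint L) : height (a.map φ) = height a := by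
  induction a using OnePoint.rec with
  | infty => rfl
  | coe x => exact (absLogHeight₁_map φ x).trans (absLogHeight₁_map (RingHom.id L) x).symm

theorem height_nonneg {L : Type*} [Field L] [CharZero L] (a : OnePoint L) : 0 ≤ height a := by
  induction a using OnePoint.rec with
  | infty => exact le_rfl
  | coe x => exact absLogHeight₁_nonneg x

/-- The Northcott property of the projective line. -/
theorem finite_setOf_height_le (K : Type*) [Field K] [NumberField K] (B : ℝ) :
    {a : OnePoint K | height a ≤ B}.Finite := by
  have h := (finite_setOfPred_logHeight₁_le K (B * Module.finrank ℚ K)).image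
    (fun x : K ↦ (x : OnePoint K))
  refine (h.insert OnePoint.infty).subset fun a ha ↦ ?_
  induction a using OnePoint.rec with
  | infty => exact Set.mem_insert _ _
  | coe x =>
    refine Set.mem_insert_of_mem _ ⟨x, ?_, rfl⟩
    have hpos : (0 : ℝ) < Module.finrank ℚ K := Nat.cast_pos.mpr Module.finrank_pos
    have hx : absLogHeight₁ x ≤ B := ha
    rwa [show x = RingHom.id K x from rfl, absLogHeight₁_map, div_le_iff₀ hpos] at hx

variable {K : Type*} [Field K] [NumberField K]

/-- Each point is defined over some finite extension of K, and the bound there does not depend on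
the extension. -/
theorem exists_abs_height_ratMap_algebraicClosure_sub_le (f : RatFunc K)
    (hd : 1 ≤ ratDegree f) :
    ∃ C : ℝ, ∀ γ : OnePoint (AlgebraicClosure K),
      |height (ratMap (AlgebraicClosure K) f γ) - ratDegree f * height γ| ≤ C := by
  obtain ⟨C, hC⟩ := exists_abs_height_ratMap_sub_le f hd
  refine ⟨C, fun γ ↦ ?_⟩
  obtain ⟨L, _, a, rfl⟩ : ∃ (L : IntermediateField K (AlgebraicClosure K)) (_ : NumberField L)
      (a : OnePoint L), a.map L.val = γ := by
    induction γ using OnePoint.rec with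
    | infty =>
      exact ⟨⊥, NumberField.of_module_finite K _, OnePoint.infty, rfl⟩
    | coe x =>
      have : FiniteDimensional K (IntermediateField.adjoin K {x}) :=
        IntermediateField.adjoin.finiteDimensional (Algebra.IsIntegral.isIntegral x)
      exact ⟨IntermediateField.adjoin K {x}, NumberField.of_module_finite K _,
        ((⟨x, IntermediateField.mem_adjoin_simple_self K x⟩ : IntermediateField.adjoin K {x}) :
          OnePoint _), rfl⟩
  have h1 := height_map (L.val : L →+* AlgebraicClosure K) a
  have h2 := height_map (L.val : L →+* AlgebraicClosure K) (ratMap L f a)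
  rw [ratMap_map]
  simp only [RingHom.coe_coe] at h1 h2
  rw [h1, h2]
  exact hC L a

theorem dist_height_iterate_div_le {f : RatFunc K} (hd : 2 ≤ ratDegree f) {C : ℝ}
    (hC : ∀ γ : OnePoint (AlgebraicClosure K),
      |height (ratMap (AlgebraicClosure K) f γ) - ratDegree f * height γ| ≤ C)
    (γ : OnePoint (AlgebraicClosure K)) (n : ℕ) :
    dist (height ((ratMap (AlgebraicClosure K) f)^[n] γ) / (ratDegree f : ℝ) ^ n)
      (height ((ratMap (AlgebraicClosure K) f)^[n + 1] γ) / (ratDegree f : ℝ) ^ (n + 1)) ≤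
      C * (1 / 2 : ℝ) ^ n := by
  have hd' : (2 : ℝ) ≤ ratDegree f := by exact_mod_cast hd
  have hpos : (0 : ℝ) < ratDegree f := by linarith
  set x := (ratMap (AlgebraicClosure K) f)^[n] γ
  have hC0 : 0 ≤ C := (abs_nonneg _).trans (hC γ)
  rw [Function.iterate_succ_apply', dist_comm, Real.dist_eq,
    show height (ratMap (AlgebraicClosure K) f x) / (ratDegree f : ℝ) ^ (n + 1) -
      height x / (ratDegree f : ℝ) ^ n =
      (height (ratMap (AlgebraicClosure K) f x) - ratDegree f * height x) /
        (ratDegree f : ℝ) ^ (n + 1) by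
      field_simp; ring, abs_div, abs_of_pos (pow_pos hpos (n + 1)),
    one_div, inv_pow, ← div_eq_mul_inv]
  refine div_le_div₀ hC0 (hC x) (by positivity) ?_
  calc (2 : ℝ) ^ n ≤ (ratDegree f : ℝ) ^ n := by gcongr
    _ ≤ (ratDegree f : ℝ) ^ (n + 1) := pow_le_pow_right₀ (by linarith) (by lia)

/-- Consecutive terms differ by at most C/2ⁿ, so the sequence is Cauchy and the `limUnder` in the
definition is a genuine limit. -/
theorem tendsto_canonicalHeight {f : RatFunc K} (hd : 2 ≤ ratDegree f)
    (γ : OnePoint (AlgebraicClosure K)) :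
    Tendsto (fun n : ℕ ↦ height ((ratMap (AlgebraicClosure K) f)^[n] γ) / (ratDegree f : ℝ) ^ n)
      atTop (𝓝 (canonicalHeight f γ)) := by
  obtain ⟨C, hC⟩ := exists_abs_height_ratMap_algebraicClosure_sub_le f (by lia)
  exact (cauchySeq_of_le_geometric (1 / 2) C (by norm_num)
    (dist_height_iterate_div_le hd hC γ)).tendsto_limUnder

theorem canonicalHeight_nonneg {f : RatFunc K} (hd : 2 ≤ ratDegree f)
    (γ : OnePoint (AlgebraicClosure K)) : 0 ≤ canonicalHeight f γ :=
  ge_of_tendsto' (tendsto_canonicalHeight hd γ) fun _ ↦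
    div_nonneg (height_nonneg _) (by positivity)

theorem canonicalHeight_ratMap {f : RatFunc K} (hd : 2 ≤ ratDegree f)
    (γ : OnePoint (AlgebraicClosure K)) :
    canonicalHeight f (ratMap (AlgebraicClosure K) f γ) = ratDegree f * canonicalHeight f γ := by
  have hpos : (0 : ℝ) < ratDegree f := by exact_mod_cast (by lia : 0 < ratDegree f)
  refine tendsto_nhds_unique (tendsto_canonicalHeight hd _) ?_
  refine (((tendsto_canonicalHeight hd γ).comp (tendsto_add_atTop_nat 1)).const_mul
    (ratDegree f : ℝ)).congr fun n ↦ ?_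
  simp only [Function.comp_apply, Function.iterate_succ_apply]
  field_simp
  ring

theorem canonicalHeight_iterate {f : RatFunc K} (hd : 2 ≤ ratDegree f) (n : ℕ)
    (γ : OnePoint (AlgebraicClosure K)) :
    canonicalHeight f ((ratMap (AlgebraicClosure K) f)^[n] γ) =
      (ratDegree f : ℝ) ^ n * canonicalHeight f γ := by
  induction n with
  | zero => simp
  | succ n ih => rw [Function.iterate_succ_apply', canonicalHeight_ratMap hd, ih]; ring

theorem exists_isHeightDifferenceBound {f : RatFunc K} (hd : 2 ≤ ratDegree f) :
    ∃ C : ℝ, IsHeightDifferenceBound f C := by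
  obtain ⟨C, hC⟩ := exists_abs_height_ratMap_algebraicClosure_sub_le f (by lia)
  refine ⟨C / (1 - 1 / 2), fun γ ↦ ?_⟩
  have h := dist_le_of_le_geometric_of_tendsto₀ (1 / 2) C (by norm_num)
    (dist_height_iterate_div_le hd hC γ) (tendsto_canonicalHeight hd γ)
  rw [dist_comm, Real.dist_eq] at h
  simpa using abs_le.mp h

/-- The canonical height is bounded away from zero on the wandering `K`-rational points. -/
theorem exists_pos_le_canonicalHeight_of_isWandering {f : RatFunc K} (hd : 2 ≤ ratDegree f) :
    ∃ δ : ℝ, 0 < δ ∧ ∀ a : OnePoint K, IsWandering K f a →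
      δ ≤ canonicalHeight f (a.map (algebraMap K (AlgebraicClosure K))) := by
  obtain ⟨C, hC⟩ := exists_isHeightDifferenceBound hd
  set g : OnePoint K → ℝ := fun a ↦
    canonicalHeight f (a.map (algebraMap K (AlgebraicClosure K)))
  have hg : ∀ a, height a ≤ g a + C := fun a ↦ by
    have := (hC (a.map (algebraMap K (AlgebraicClosure K)))).1
    rw [height_map] at this
    linarith
  have hiter : ∀ n a, g ((ratMap K f)^[n] a) = (ratDegree f : ℝ) ^ n * g a := fun n a ↦ by
    have h : (ratMap (AlgebraicClosure K) f)^[n] (a.map (algebraMap K (AlgebraicClosure K))) =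
        ((ratMap K f)^[n] a).map (algebraMap K (AlgebraicClosure K)) :=
      ratMap_iterate_map (Algebra.ofId K (AlgebraicClosure K)) f n a
    simp only [g]
    rw [← h, canonicalHeight_iterate hd]
  -- If ĥ vanishes at `a`, the whole orbit has height at most C and is finite by Northcott.
  have hpos : ∀ a, IsWandering K f a → 0 < g a := fun a ha ↦ by
    refine (canonicalHeight_nonneg hd _).lt_of_ne' fun h0 ↦ ha ?_
    refine (finite_setOf_height_le K C).subset ?_
    rintro _ ⟨n, rfl⟩
    have := hg ((ratMap K f)^[n] a)
    rwa [hiter, show g a = 0 from h0, mul_zero, zero_add] at this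
  -- Points of height above 1 + C have ĥ ≥ 1, so only a finite set is left to minimize over.
  have hfin : ({a | 0 < g a ∧ height a ≤ 1 + C} : Set (OnePoint K)).Finite :=
    (finite_setOf_height_le K (1 + C)).subset fun a ha ↦ ha.2
  obtain ⟨δ, hδ, hmin⟩ : ∃ δ : ℝ, 0 < δ ∧ ∀ a, 0 < g a → height a ≤ 1 + C → δ ≤ g a := by
    rcases Set.eq_empty_or_nonempty {a | 0 < g a ∧ height a ≤ 1 + C} with he | hne
    · exact ⟨1, one_pos, fun a h h' ↦ (Set.eq_empty_iff_forall_notMem.mp he a ⟨h, h'⟩).elim⟩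
    · obtain ⟨b, hb, hmin⟩ := Set.exists_min_image _ g hfin hne
      exact ⟨g b, hb.1, fun a h h' ↦ hmin a ⟨h, h'⟩⟩
  refine ⟨min δ 1, lt_min hδ one_pos, fun a ha ↦ ?_⟩
  by_cases h : height a ≤ 1 + C
  · exact (min_le_left _ _).trans (hmin a (hpos a ha) h)
  · have := hg a
    exact (min_le_right _ _).trans (show 1 ≤ g a by linarith)

end OrbitRelation

/-! ### Split multilinear relations and the key inequality. -/

namespace OrbitRelation

open NumberField

/-- The exponent of the squarefree monomial supported on `J`. -/
noncomputable def sqfreeExponent {σ : Type*} (J : Finset σ) : σ →₀ ℕ :=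
  ∑ j ∈ J, Finsupp.single j 1

theorem sqfreeExponent_injective {σ : Type*} :
    Function.Injective (sqfreeExponent : Finset σ → σ →₀ ℕ) := by
  classical
  intro I J h
  ext i
  have hI : ∀ J : Finset σ, sqfreeExponent J i = if i ∈ J then 1 else 0 := fun J ↦ by
    simp [sqfreeExponent, Finsupp.single_apply]
  have := DFunLike.congr_fun h i
  rw [hI, hI] at this
  by_cases h1 : i ∈ I <;> by_cases h2 : i ∈ J <;> simp_all

variable {K : Type*} [Field K] [NumberField K]

theorem polyHeight_nonneg {k : ℕ} (F : MvPolynomial (Fin k) K) : 0 ≤ polyHeight F :=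
  Real.iSup_nonneg fun _ ↦ absLogHeight₁_nonneg _

/-- Distinct blocks have distinct squarefree monomials, so nothing cancels and each scalar is a
coefficient of F. -/
theorem absLogHeight₁_le_polyHeight {k : ℕ}
    {P : Finpartition (Finset.univ : Finset (Fin k))} {c : Finset (Fin k) → K}
    (hc : ∀ J ∈ P.parts, c J ≠ 0) {I : Finset (Fin k)} (hI : I ∈ P.parts) :
    absLogHeight₁ (c I) ≤
      polyHeight (∑ J ∈ P.parts, MvPolynomial.C (c J) * ∏ j ∈ J, MvPolynomial.X j) := by
  set F := ∑ J ∈ P.parts, MvPolynomial.C (c J) * ∏ j ∈ J, MvPolynomial.X j with hF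
  have hcoeff : F.coeff (sqfreeExponent I) = c I := by
    have hmon : ∀ J : Finset (Fin k), MvPolynomial.C (c J) * ∏ j ∈ J, MvPolynomial.X j =
        MvPolynomial.monomial (sqfreeExponent J) (c J) := by
      intro J
      rw [sqfreeExponent, MvPolynomial.monomial_sum_index]
      rfl
    rw [hF, MvPolynomial.coeff_sum, Finset.sum_eq_single I]
    · rw [hmon, MvPolynomial.coeff_monomial, if_pos rfl]
    · intro J _ hne
      rw [hmon, MvPolynomial.coeff_monomial, if_neg (sqfreeExponent_injective.ne hne)]
    · exact fun h ↦ (h hI).elim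
  have hmem : sqfreeExponent I ∈ F.support := by
    rw [MvPolynomial.mem_support_iff, hcoeff]
    exact hc I hI
  rw [← hcoeff]
  exact le_ciSup (f := fun m : F.support ↦ absLogHeight₁ (F.coeff m)) (Set.finite_range _).bddAbove
    ⟨_, hmem⟩

/-- In a relation `F(x) = 0` without zero entries, the height of each entry is bounded in terms of
the heights of the other ones. -/
theorem absLogHeight₁_le_sum_of_aeval_eq_zero {E : Type*} [Field E] [CharZero E]
    [Algebra.IsAlgebraic ℚ E] [Algebra K E] {k : ℕ} {F : MvPolynomial (Fin k) K}
    (hF : IsSplitMultilinear F) {x : Fin k → E} (hx : ∀ i, x i ≠ 0)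
    (hFx : MvPolynomial.aeval x F = 0) (i : Fin k) :
    2 ≤ k ∧ absLogHeight₁ (x i) ≤
      ∑ j ∈ Finset.univ.erase i, absLogHeight₁ (x j) + k * polyHeight F + Real.log (k - 1) := by
  obtain ⟨P, c, hc, rfl⟩ := hF
  set H := polyHeight (∑ J ∈ P.parts, MvPolynomial.C (c J) * ∏ j ∈ J, MvPolynomial.X j)
  have hH : 0 ≤ H := polyHeight_nonneg _
  have hcH : ∀ J ∈ P.parts, absLogHeight₁ (algebraMap K E (c J)) ≤ H := fun J hJ ↦ by
    rw [absLogHeight₁_map, ← absLogHeight₁_map (RingHom.id K)]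
    exact absLogHeight₁_le_polyHeight hc hJ
  obtain ⟨I, hI, hiI⟩ := P.exists_mem (Finset.mem_univ i)
  set S := P.parts.erase I
  have hrel : algebraMap K E (c I) * (x i * ∏ j ∈ I.erase i, x j) +
      ∑ J ∈ S, algebraMap K E (c J) * ∏ j ∈ J, x j = 0 := by
    rw [Finset.mul_prod_erase I x hiI,
      Finset.add_sum_erase _ (fun J ↦ algebraMap K E (c J) * ∏ j ∈ J, x j) hI]
    simpa using hFx
  have hcI : algebraMap K E (c I) ≠ 0 := by simpa using hc I hI
  have hprod : ∏ j ∈ I.erase i, x j ≠ 0 := Finset.prod_ne_zero_iff.mpr fun j _ ↦ hx j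
  have hxi : x i = (∑ J ∈ S, algebraMap K E (c J) * ∏ j ∈ J, x j) *
      (-(algebraMap K E (c I) * ∏ j ∈ I.erase i, x j))⁻¹ := by
    rw [eq_mul_inv_iff_mul_eq₀ (neg_ne_zero.mpr (mul_ne_zero hcI hprod))]
    linear_combination -hrel
  have hcard : P.parts.card ≤ k := by simpa using P.card_parts_le_card
  have hScard : S.card + 1 = P.parts.card := Finset.card_erase_add_one hI
  -- With a single block, a nonzero product would have to vanish; this forces k ≥ 2.
  have hS : 1 ≤ S.card := by
    rw [Nat.one_le_iff_ne_zero, Ne, Finset.card_eq_zero]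
    intro h
    rw [h, Finset.sum_empty, zero_mul] at hxi
    exact hx i hxi
  refine ⟨by lia, ?_⟩
  have hlog : Real.log S.card ≤ Real.log (k - 1) := by
    refine Real.log_le_log (by positivity) ?_
    have : (S.card : ℝ) + 1 ≤ k := by exact_mod_cast hScard.trans_le hcard
    linarith
  have hnum : absLogHeight₁ (∑ J ∈ S, algebraMap K E (c J) * ∏ j ∈ J, x j) ≤
      Real.log S.card + ∑ J ∈ S, (H + ∑ j ∈ J, absLogHeight₁ (x j)) := by
    refine (absLogHeight₁_sum_le _ _).trans ?_
    gcongr with J hJ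
    exact (absLogHeight₁_mul_le _ _).trans
      (add_le_add (hcH J (Finset.mem_of_mem_erase hJ)) (absLogHeight₁_prod_le _ _))
  have hden : absLogHeight₁ (-(algebraMap K E (c I) * ∏ j ∈ I.erase i, x j))⁻¹ ≤
      H + ∑ j ∈ I.erase i, absLogHeight₁ (x j) := by
    rw [absLogHeight₁_inv, absLogHeight₁_neg]
    exact (absLogHeight₁_mul_le _ _).trans (add_le_add (hcH I hI) (absLogHeight₁_prod_le _ _))
  have hsum : ∑ J ∈ S, ∑ j ∈ J, absLogHeight₁ (x j) + ∑ j ∈ I.erase i, absLogHeight₁ (x j) =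
      ∑ j ∈ Finset.univ.erase i, absLogHeight₁ (x j) := by
    have h1 := Finset.add_sum_erase P.parts (fun J ↦ ∑ j ∈ J, absLogHeight₁ (x j)) hI
    have h2 := Finset.add_sum_erase I (fun j ↦ absLogHeight₁ (x j)) hiI
    have h3 := Finset.add_sum_erase Finset.univ (fun j ↦ absLogHeight₁ (x j)) (Finset.mem_univ i)
    have h4 : ∑ J ∈ P.parts, ∑ j ∈ J, absLogHeight₁ (x j) = ∑ j, absLogHeight₁ (x j) :=
      (Finset.sum_biUnion P.disjoint).symm.trans (by rw [P.biUnion_parts])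
    linarith
  have hkH : (S.card : ℝ) * H + H ≤ k * H := by
    have : (S.card : ℝ) + 1 ≤ k := by exact_mod_cast hScard.trans_le hcard
    nlinarith
  calc absLogHeight₁ (x i) ≤ _ := (congrArg absLogHeight₁ hxi).trans_le (absLogHeight₁_mul_le _ _)
    _ ≤ _ := add_le_add hnum hden
    _ ≤ _ := by
      rw [Finset.sum_add_distrib, Finset.sum_const, nsmul_eq_mul]
      linarith

/-- Sums of distinct powers of `d` below `d ^ m` fall short of `d ^ m` by at least the geometric
remainder. -/
theorem sum_pow_add_pow_le {d : ℕ} (hd : 2 ≤ d) :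
    ∀ (m : ℕ) (S : Finset ℕ), (∀ n ∈ S, n < m) → ∑ n ∈ S, d ^ n + d ^ (m - S.card) ≤ d ^ m := by
  intro m
  induction m with
  | zero =>
    intro S hS
    obtain rfl : S = ∅ := Finset.eq_empty_of_forall_notMem fun n hn ↦ by simpa using hS n hn
    simp
  | succ m ih =>
    intro S hS
    -- If m ∈ S, the inequality 2 * d ^ m ≤ d ^ (m + 1) absorbs the extra term; otherwise the
    -- induction hypothesis is multiplied by d.
    by_cases hm : m ∈ S
    · have h := ih (S.erase m) fun n hn ↦ by
        have := hS n (Finset.mem_of_mem_erase hn)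
        have := Finset.ne_of_mem_erase hn
        lia
      have hc := Finset.card_erase_add_one hm
      rw [← Finset.add_sum_erase _ _ hm, ← hc, Nat.add_sub_add_right, pow_succ]
      have := Nat.mul_le_mul_left (d ^ m) hd
      lia
    · have hS' : ∀ n ∈ S, n < m := fun n hn ↦ by
        have := hS n hn
        have : n ≠ m := fun h ↦ hm (h ▸ hn)
        lia
      have hcard : S.card ≤ m := by
        simpa using Finset.card_le_card (t := Finset.range m) fun n hn ↦ by simpa using hS' n hn
      have h := ih S hS'
      rw [Nat.sub_add_comm hcard, pow_succ, pow_succ]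
      nlinarith [Nat.zero_le (∑ n ∈ S, d ^ n)]

/-- The full geometric sum is (d ^ m - 1) / (d - 1), and d - 1 ≥ 2. -/
theorem two_mul_sum_pow_le {d : ℕ} (hd : 3 ≤ d) {m : ℕ} {S : Finset ℕ} (hS : ∀ n ∈ S, n < m) :
    2 * ∑ n ∈ S, d ^ n ≤ d ^ m := by
  have h1 : ∑ n ∈ S, d ^ n ≤ ∑ n ∈ Finset.range m, d ^ n :=
    Finset.sum_le_sum_of_subset fun n hn ↦ by simpa using hS n hn
  have h2 := Nat.geomSum_eq (by lia : 2 ≤ d) m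
  have h3 := Nat.div_le_div_left (a := d ^ m - 1) (by lia : 2 ≤ d - 1) (by lia)
  lia

variable {k : ℕ} {F : MvPolynomial (Fin k) K} {f : RatFunc K} {C : ℝ}
  {a : OnePoint (AlgebraicClosure K)} {n : Fin k → ℕ} {x : Fin k → AlgebraicClosure K}

theorem IsHeightDifferenceBound.nonneg (hC : IsHeightDifferenceBound f C) : 0 ≤ C := by
  have := hC OnePoint.infty
  linarith

/-- The bound for the canonical height coming from a zero in the orbit. -/
theorem canonicalHeight_le_of_iterate_eq_zero (hd : 2 ≤ ratDegree f)
    (hC : IsHeightDifferenceBound f C) {m : ℕ}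
    (hm : (ratMap (AlgebraicClosure K) f)^[m] a = ((0 : AlgebraicClosure K) : OnePoint _)) :
    (ratDegree f : ℝ) ^ m * canonicalHeight f a ≤ C := by
  have h := (hC ((ratMap (AlgebraicClosure K) f)^[m] a)).2
  have h0 : height ((0 : AlgebraicClosure K) : OnePoint (AlgebraicClosure K)) = 0 :=
    absLogHeight₁_zero
  rwa [canonicalHeight_iterate hd, hm, h0, sub_zero] at h

/-- The canonical height inequality coming from a relation without zero entries. -/
theorem pow_mul_canonicalHeight_le (hF : IsSplitMultilinear F) (hd : 2 ≤ ratDegree f)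
    (hC : IsHeightDifferenceBound f C)
    (hn : ∀ i, (ratMap (AlgebraicClosure K) f)^[n i] a = (x i : OnePoint (AlgebraicClosure K)))
    (hFx : MvPolynomial.aeval x F = 0) (hx : ∀ i, x i ≠ 0) (i : Fin k) :
    2 ≤ k ∧ (ratDegree f : ℝ) ^ n i * canonicalHeight f a ≤
      (∑ j ∈ Finset.univ.erase i, (ratDegree f : ℝ) ^ n j) * canonicalHeight f a +
        (k * C + k * polyHeight F + Real.log (k - 1)) := by
  have : Algebra.IsAlgebraic ℚ (AlgebraicClosure K) := Algebra.IsAlgebraic.trans ℚ K _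
  obtain ⟨hk, h⟩ := absLogHeight₁_le_sum_of_aeval_eq_zero hF hx hFx i
  refine ⟨hk, ?_⟩
  have hup : ∀ j, absLogHeight₁ (x j) ≤ (ratDegree f : ℝ) ^ n j * canonicalHeight f a + C := by
    intro j
    have := (hC ((ratMap (AlgebraicClosure K) f)^[n j] a)).1
    rw [canonicalHeight_iterate hd, hn] at this
    change -C ≤ _ - absLogHeight₁ (x j) at this
    linarith
  have hlo := (hC ((ratMap (AlgebraicClosure K) f)^[n i] a)).2
  rw [canonicalHeight_iterate hd, hn] at hlo
  change _ - absLogHeight₁ (x i) ≤ C at hlo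
  -- The k - 1 upper comparisons and the single lower one cost C each, in total kC.
  have hsum := Finset.sum_le_sum fun j (_ : j ∈ Finset.univ.erase i) ↦ hup j
  have hcard : ((Finset.univ.erase i).card : ℝ) + 1 = k := by
    exact_mod_cast (Finset.card_erase_add_one (Finset.mem_univ i)).trans (by simp)
  rw [Finset.sum_add_distrib, Finset.sum_const, nsmul_eq_mul, ← Finset.sum_mul] at hsum
  rw [← hcard]
  rw [← hcard] at h
  linarith

/-- The key estimate: the canonical height of a solution without zero entries decays exponentially
in the largest index. -/
theorem pow_sub_mul_canonicalHeight_le (hF : IsSplitMultilinear F) (hd : 2 ≤ ratDegree f)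
    (hC : IsHeightDifferenceBound f C)
    (hn : ∀ i, (ratMap (AlgebraicClosure K) f)^[n i] a = (x i : OnePoint (AlgebraicClosure K)))
    (hinj : Function.Injective n) (hFx : MvPolynomial.aeval x F = 0) (hx : ∀ i, x i ≠ 0)
    {i : Fin k} (hi : ∀ j, n j ≤ n i) :
    (ratDegree f : ℝ) ^ (n i - (k - 1)) * canonicalHeight f a ≤
        k * C + k * polyHeight F + Real.log (k - 1) ∧
      (3 ≤ ratDegree f → (ratDegree f : ℝ) ^ n i * canonicalHeight f a ≤
        2 * (k * C + k * polyHeight F + Real.log (k - 1))) := by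
  obtain ⟨-, h⟩ := pow_mul_canonicalHeight_le hF hd hC hn hFx hx i
  have h0 := canonicalHeight_nonneg hd a
  set S := (Finset.univ.erase i).image n with hSdef
  have hS : ∀ m ∈ S, m < n i := by
    intro m hm
    obtain ⟨j, hj, rfl⟩ := Finset.mem_image.mp hm
    exact (hi j).lt_of_ne (hinj.ne (Finset.ne_of_mem_erase hj))
  have hScard : S.card = k - 1 := by
    rw [hSdef, Finset.card_image_of_injective _ hinj, Finset.card_erase_of_mem (Finset.mem_univ i)]
    simp
  have hsum : ∑ m ∈ S, ratDegree f ^ m = ∑ j ∈ Finset.univ.erase i, ratDegree f ^ n j :=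
    Finset.sum_image hinj.injOn
  constructor
  · have h1 := sum_pow_add_pow_le hd (n i) S hS
    rw [hsum, hScard] at h1
    have h2 : ∑ j ∈ Finset.univ.erase i, (ratDegree f : ℝ) ^ n j +
        (ratDegree f : ℝ) ^ (n i - (k - 1)) ≤ (ratDegree f : ℝ) ^ n i := by exact_mod_cast h1
    nlinarith
  · intro hd3
    have h1 := two_mul_sum_pow_le hd3 hS
    rw [hsum] at h1
    have h2 : 2 * ∑ j ∈ Finset.univ.erase i, (ratDegree f : ℝ) ^ n j ≤
        (ratDegree f : ℝ) ^ n i := by exact_mod_cast h1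
    nlinarith

theorem sub_one_le_of_injective (hinj : Function.Injective n) {i : Fin k}
    (hi : ∀ j, n j ≤ n i) : k - 1 ≤ n i := by
  have := Finset.card_le_card_of_injOn n (s := Finset.univ) (t := Finset.range (n i + 1))
    (fun j _ ↦ by simpa using Nat.lt_succ_of_le (hi j)) hinj.injOn
  simp only [Finset.card_univ, Fintype.card_fin, Finset.card_range] at this
  lia

/-- Here k = j + 2. Bernoulli's inequality suffices, with equality at k = 2; adding the C from
comparing h with ĥ produces 7/3. -/
theorem mul_two_div_three_pow_le (j : ℕ) : (2 * (j + 2) : ℝ) / 3 ^ (j + 1) ≤ 4 / 3 := by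
  rw [div_le_div_iff₀ (by positivity) (by norm_num)]
  have h := one_add_mul_le_pow (a := (2 : ℝ)) (by norm_num) j
  norm_num at h
  rw [pow_succ]
  nlinarith

/-- Equality holds at j = 1, that is k = 3. From there each step adds at most log 2 to the
logarithm, while the power triples. -/
theorem two_mul_log_div_three_pow_le (j : ℕ) :
    2 * Real.log (j + 1) / 3 ^ (j + 1) ≤ 2 / 9 * Real.log 2 := by
  have key : ∀ j : ℕ, 1 ≤ j → 3 * Real.log (j + 1) ≤ 3 ^ j * Real.log 2 := by
    intro j hj
    induction j, hj using Nat.le_induction with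
    | base => norm_num
    | succ j hj ih =>
      have hj' : (1 : ℝ) ≤ j := by exact_mod_cast hj
      have h1 : Real.log (((j + 1 : ℕ) : ℝ) + 1) ≤ Real.log 2 + Real.log (j + 1) := by
        rw [← Real.log_mul (by norm_num) (by positivity)]
        refine Real.log_le_log (by positivity) ?_
        push_cast
        linarith
      have h2 : (3 : ℝ) ≤ 3 ^ j := by
        calc (3 : ℝ) = 3 ^ 1 := by norm_num
          _ ≤ 3 ^ j := pow_le_pow_right₀ (by norm_num) hj
      have h3 : 0 < Real.log 2 := Real.log_pos (by norm_num)
      rw [pow_succ]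
      nlinarith
  rcases Nat.eq_zero_or_pos j with rfl | hj
  · simp [Real.log_nonneg]
  · rw [div_le_iff₀ (by positivity), pow_succ]
    have := key j hj
    linarith

end OrbitRelation

/-! ### Bounded height, the explicit bound, and uniform finiteness. -/

namespace OrbitRelation

open NumberField

variable {K : Type*} [Field K] [NumberField K] {k : ℕ} {F : MvPolynomial (Fin k) K} {f : RatFunc K}

/-- The case k = 1 rests on the convention log 0 = 0. -/
theorem log_natCast_sub_one_nonneg {k : ℕ} (hk : 1 ≤ k) : 0 ≤ Real.log ((k : ℝ) - 1) := by
  rw [← Nat.cast_pred hk]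
  exact Real.log_natCast_nonneg _

theorem exists_absLogHeight₁_le_of_mem_exceptionalSet (hk : 1 ≤ k) (hF : IsSplitMultilinear F)
    (hd : 2 ≤ ratDegree f) :
    ∃ B : ℝ, ∀ α ∈ exceptionalSet f F, absLogHeight₁ α ≤ B := by
  obtain ⟨C, hC⟩ := exists_isHeightDifferenceBound hd
  have hC0 := hC.nonneg
  have hH0 := polyHeight_nonneg F
  have hlog := log_natCast_sub_one_nonneg hk
  have hd1 : (1 : ℝ) ≤ ratDegree f := by exact_mod_cast (by lia : 1 ≤ ratDegree f)
  -- The first C compares h with ĥ, the second covers a zero entry, and the rest covers relations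
  -- without zeros.
  refine ⟨C + (C + (k * C + k * polyHeight F + Real.log (k - 1))), ?_⟩
  rintro α ⟨n, hinj, x, hn, hFx⟩
  have h0 := canonicalHeight_nonneg hd (α : OnePoint (AlgebraicClosure K))
  have hα := (hC (α : OnePoint (AlgebraicClosure K))).1
  change -C ≤ _ - absLogHeight₁ α at hα
  have hB : (0 : ℝ) ≤ k * C + k * polyHeight F := by positivity
  by_cases hx : ∀ i, x i ≠ 0
  · have : Nonempty (Fin k) := ⟨⟨0, hk⟩⟩
    obtain ⟨i, hi⟩ := Finite.exists_max n
    have h := (pow_sub_mul_canonicalHeight_le hF hd hC hn hinj hFx hx hi).1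
    have h1 := le_mul_of_one_le_left h0 (one_le_pow₀ hd1 (n := n i - (k - 1)))
    linarith
  · push Not at hx
    obtain ⟨i, hi⟩ := hx
    have h := canonicalHeight_le_of_iterate_eq_zero hd hC ((hn i).trans (by rw [hi]))
    have h1 := le_mul_of_one_le_left h0 (one_le_pow₀ hd1 (n := n i))
    linarith

theorem absLogHeight₁_le_of_mem_exceptionalSet (hF : IsSplitMultilinear F)
    (hd : 3 ≤ ratDegree f) {C : ℝ} (hC : IsHeightDifferenceBound f C)
    {α : AlgebraicClosure K} (hα : α ∈ exceptionalSet f F) (hk : 1 ≤ k) :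
    absLogHeight₁ α ≤ 2 * (k : ℝ) / (ratDegree f : ℝ) ^ (k - 1) * polyHeight F
      + 7 / 3 * C + 2 / 9 * Real.log 2 := by
  obtain ⟨n, hinj, x, hn, hFx⟩ := hα
  have hd2 : 2 ≤ ratDegree f := by lia
  have hd3 : (3 : ℝ) ≤ ratDegree f := by exact_mod_cast hd
  have hd1 : (1 : ℝ) ≤ ratDegree f := by linarith
  have hdpos : (0 : ℝ) < ratDegree f := by linarith
  have hC0 := hC.nonneg
  have hH0 := polyHeight_nonneg F
  have h0 := canonicalHeight_nonneg hd2 (α : OnePoint (AlgebraicClosure K))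
  have hα := (hC (α : OnePoint (AlgebraicClosure K))).1
  change -C ≤ _ - absLogHeight₁ α at hα
  have hlog2 : 0 < Real.log 2 := Real.log_pos (by norm_num)
  have hmain : 0 ≤ 2 * (k : ℝ) / (ratDegree f : ℝ) ^ (k - 1) * polyHeight F := by positivity
  by_cases hx : ∀ i, x i ≠ 0
  · have : Nonempty (Fin k) := ⟨⟨0, hk⟩⟩
    obtain ⟨i, hi⟩ := Finite.exists_max n
    have hk2 := (pow_mul_canonicalHeight_le hF hd2 hC hn hFx hx i).1
    have h := (pow_sub_mul_canonicalHeight_le hF hd2 hC hn hinj hFx hx hi).2 hd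
    have hni := sub_one_le_of_injective hinj hi
    have h1 : (ratDegree f : ℝ) ^ (k - 1) * canonicalHeight f (α : OnePoint (AlgebraicClosure K)) ≤
        2 * (k * C + k * polyHeight F + Real.log (k - 1)) :=
      (mul_le_mul_of_nonneg_right (pow_le_pow_right₀ hd1 hni) h0).trans h
    rw [mul_comm, ← le_div_iff₀ (by positivity)] at h1
    obtain ⟨j, rfl⟩ : ∃ j, k = j + 2 := ⟨k - 2, by lia⟩
    have hpow : (3 : ℝ) ^ (j + 1) ≤ (ratDegree f : ℝ) ^ (j + 1) := by gcongr
    have e1 : 2 * ((j + 2 : ℕ) : ℝ) / (ratDegree f : ℝ) ^ (j + 1) ≤ 4 / 3 := by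
      refine le_trans ?_ (mul_two_div_three_pow_le j)
      push_cast
      gcongr
    have e2 : 2 * Real.log (((j + 2 : ℕ) : ℝ) - 1) / (ratDegree f : ℝ) ^ (j + 1) ≤
        2 / 9 * Real.log 2 := by
      have hj : ((j + 2 : ℕ) : ℝ) - 1 = j + 1 := by push_cast; ring
      have hlog := log_natCast_sub_one_nonneg hk
      rw [hj] at hlog ⊢
      refine le_trans ?_ (two_mul_log_div_three_pow_le j)
      gcongr
    have e3 := mul_le_mul_of_nonneg_right e1 hC0
    rw [show j + 2 - 1 = j + 1 from rfl] at h1 ⊢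
    rw [show 2 * (((j + 2 : ℕ) : ℝ) * C + ((j + 2 : ℕ) : ℝ) * polyHeight F +
        Real.log (((j + 2 : ℕ) : ℝ) - 1)) / (ratDegree f : ℝ) ^ (j + 1) =
      2 * ((j + 2 : ℕ) : ℝ) / (ratDegree f : ℝ) ^ (j + 1) * C +
      2 * ((j + 2 : ℕ) : ℝ) / (ratDegree f : ℝ) ^ (j + 1) * polyHeight F +
      2 * Real.log (((j + 2 : ℕ) : ℝ) - 1) / (ratDegree f : ℝ) ^ (j + 1) by ring] at h1
    linarith
  · push Not at hx
    obtain ⟨i, hi⟩ := hx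
    have hzero := (hn i).trans (by rw [hi])
    -- A zero at index 0 means α = 0; at a later index ĥ(α) ≤ C/3, so h(α) ≤ 4C/3.
    rcases Nat.eq_zero_or_pos (n i) with h | h
    · rw [h, Function.iterate_zero, id, OnePoint.coe_eq_coe] at hzero
      rw [hzero, absLogHeight₁_zero]
      positivity
    · have h1 := canonicalHeight_le_of_iterate_eq_zero hd2 hC hzero
      have h2 : (3 : ℝ) ≤ (ratDegree f : ℝ) ^ n i :=
        hd3.trans (le_self_pow₀ hd1 h.ne')
      have h3 := (mul_le_mul_of_nonneg_right h2 h0).trans h1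
      linarith

theorem exists_card_solutions_le (hk : 1 ≤ k) (hF : IsSplitMultilinear F)
    (hd : 2 ≤ ratDegree f) :
    ∃ N : ℕ, ∀ a : OnePoint K, IsWandering K f a →
      ((0 : K) : OnePoint K) ∉ orbit K f a →
        {n : Fin k → ℕ | StrictAnti n ∧ IsSolution K f F a n}.Finite ∧
        {n : Fin k → ℕ | StrictAnti n ∧ IsSolution K f F a n}.ncard ≤ N := by
  obtain ⟨C, hC⟩ := exists_isHeightDifferenceBound hd
  obtain ⟨δ, hδ, hmin⟩ := exists_pos_le_canonicalHeight_of_isWandering hd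
  set B := k * C + k * polyHeight F + Real.log (k - 1)
  -- With m = n_i - (k - 1), the estimate m ≤ 2^m ≤ d^m ≤ B/δ puts all indices in a box independent
  -- of the point.
  set M := k - 1 + ⌊B / δ⌋₊
  refine ⟨(Fintype.piFinset fun _ : Fin k ↦ Finset.range (M + 1)).card, fun a ha h0 ↦ ?_⟩
  have hsub : {n : Fin k → ℕ | StrictAnti n ∧ IsSolution K f F a n} ⊆
      (Fintype.piFinset fun _ : Fin k ↦ Finset.range (M + 1) : Finset (Fin k → ℕ)) := by
    rintro n ⟨hanti, x, hn, hFx⟩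
    have hx : ∀ i, algebraMap K (AlgebraicClosure K) (x i) ≠ 0 := fun i hi ↦ by
      rw [FaithfulSMul.algebraMap_eq_zero_iff] at hi
      exact h0 ⟨n i, (hn i).trans (by rw [hi])⟩
    have hn' : ∀ i, (ratMap (AlgebraicClosure K) f)^[n i]
        (a.map (algebraMap K (AlgebraicClosure K))) =
        (algebraMap K (AlgebraicClosure K) (x i) : OnePoint (AlgebraicClosure K)) := fun i ↦ by
      refine (ratMap_iterate_map (Algebra.ofId K (AlgebraicClosure K)) f (n i) a).trans ?_
      rw [hn i]
      rfl
    have hFx' : MvPolynomial.aeval (fun i ↦ algebraMap K (AlgebraicClosure K) (x i)) F = 0 := by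
      have := MvPolynomial.aeval_algebraMap_apply (AlgebraicClosure K) x F
      rw [hFx, map_zero] at this
      exact this
    have : Nonempty (Fin k) := ⟨⟨0, hk⟩⟩
    obtain ⟨i, hi⟩ := Finite.exists_max n
    have h := (pow_sub_mul_canonicalHeight_le hF hd hC hn' hanti.injective hFx' hx hi).1
    have h1 : ((n i - (k - 1) : ℕ) : ℝ) ≤ B / δ := by
      rw [le_div_iff₀ hδ]
      refine le_trans ?_ h
      refine mul_le_mul ?_ (hmin a ha) hδ.le (by positivity)
      exact_mod_cast (Nat.lt_two_pow_self.trans_le (Nat.pow_le_pow_left hd _)).le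
    have h2 := Nat.le_floor h1
    simp only [Finset.mem_coe, Fintype.mem_piFinset, Finset.mem_range]
    intro j
    have := hi j
    lia
  exact ⟨(Finset.finite_toSet _).subset hsub,
    (Set.ncard_le_ncard hsub (Finset.finite_toSet _)).trans_eq (Set.ncard_coe_finset _)⟩

end OrbitRelation

theorem theorem1p10 {K : Type*} [Field K] [NumberField K] (k : ℕ) (hk : 1 ≤ k)
    (F : MvPolynomial (Fin k) K) (hF : OrbitRelation.IsSplitMultilinear F)
    (f : RatFunc K) (hd : 2 ≤ OrbitRelation.ratDegree f) :
    -- (a) the exceptional set has bounded height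
    (∃ B : ℝ, ∀ α ∈ OrbitRelation.exceptionalSet f F, NumberField.absLogHeight₁ α ≤ B) ∧
    -- (b) the explicit bound in degree at least 3, for every constant (and there is one) that
    -- bounds the difference of the canonical height and the Weil height
    ((∃ C₁ : ℝ, OrbitRelation.IsHeightDifferenceBound f C₁) ∧
      (3 ≤ OrbitRelation.ratDegree f →
        ∀ C₁ : ℝ, OrbitRelation.IsHeightDifferenceBound f C₁ →
          ∀ α ∈ OrbitRelation.exceptionalSet f F,
            NumberField.absLogHeight₁ α ≤
              2 * (k : ℝ) / (OrbitRelation.ratDegree f : ℝ) ^ (k - 1) *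
                  OrbitRelation.polyHeight F
                + 7 / 3 * C₁ + 2 / 9 * Real.log 2)) ∧
    -- (c) finiteness of the number of solutions, uniformly in the wandering point
    (∃ N : ℕ, ∀ a : OnePoint K, OrbitRelation.IsWandering K f a →
      ((0 : K) : OnePoint K) ∉ OrbitRelation.orbit K f a →
        {n : Fin k → ℕ | StrictAnti n ∧ OrbitRelation.IsSolution K f F a n}.Finite ∧
        {n : Fin k → ℕ | StrictAnti n ∧ OrbitRelation.IsSolution K f F a n}.ncard ≤ N) := 
  ⟨OrbitRelation.exists_absLogHeight₁_le_of_mem_exceptionalSet hk hF hd,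
    ⟨OrbitRelation.exists_isHeightDifferenceBound hd, fun hd3 _ hC _ hα ↦
      OrbitRelation.absLogHeight₁_le_of_mem_exceptionalSet hF hd3 hC hα hk⟩,
    OrbitRelation.exists_card_solutions_le hk hF hd⟩
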